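/- Let $K$ be a compact convex subset of a (Hausdorff) locally convex topological vector space. Let $C(K)$ be the space of continuous complex-valued functions on $K$, $A(K) \subseteq C(K)$ the space of continuous affine complex-valued functions, $P(K)$ the set of continuous convex real-valued functions on $K$, and $M^+(K)$ the set of finite positive regular Borel measures on $K$. For $\mu, \nu \in M^+(K)$ write $\mu \prec \nu$ (classical Choquet order) if $\int f\,d\mu \le \int f\,d\nu$ for all $f \in P(K)$. Let $\pi_\mu : C(K) \to \mathcal{B}(L^2(\mu))$, $\pi_\mu(f) = M_f$, be the representation by multiplication operators, and regard $L^\infty(\mu)$ as acting on $L^2(\mu)$ by multiplication. Write $\mu \prec_s \nu$ (strong dilation order) if there is a positive linear map $\Phi : C(K) \to L^\infty(\mu)$ such that \[ \Phi(a) = \pi_\mu(a) \quad\text{for all } a \in A(K) \qquad\text{and}\qquad \int f\,d\nu = \langle \Phi(f) 1_\mu, 1_\mu \rangle \quad\text{for all } f \in C(K), \] where $1_\mu \in L^2(\mu)$ is the constant function $1$ and the inner product is linear in the first variable. Then for all $\mu, \nu \in M^+(K)$: $\mu \prec \nu$ if and only if $\mu \prec_s \nu$. -/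

import Mathlib

open MeasureTheory
open scoped ComplexOrder ENNReal

noncomputable section

namespace ChoquetDilation

section Convexity

variable {E : Type*} [AddCommGroup E] [Module ℝ E] [TopologicalSpace E] {K : Set E}

/-- The space `P(K)` of continuous convex real-valued functions on the set `K`. -/
def convexFunctions (K : Set E) : Set C(K, ℝ) :=
  {f | ∀ (x y z : K) (a b : ℝ), 0 ≤ a → 0 ≤ b → a + b = 1 → (z : E) = a • (x : E) + b • (y : E) →
    f z ≤ a * f x + b * f y}

/-- The space `A(K)` of continuous affine complex-valued functions on the set `K`. -/
def affineFunctions (K : Set E) : Set C(K, ℂ) :=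
  {f | ∀ (x y z : K) (a b : ℝ), 0 ≤ a → 0 ≤ b → a + b = 1 → (z : E) = a • (x : E) + b • (y : E) →
    f z = a * f x + b * f y}

/-- The classical Choquet order `μ ≺ ν`. -/
def ChoquetLE [MeasurableSpace K] (μ ν : Measure K) : Prop :=
  ∀ f ∈ convexFunctions K, ∫ x, f x ∂μ ≤ ∫ x, f x ∂ν

end Convexity

section Operators

variable {X : Type*} [MeasurableSpace X]

/-- The multiplication operator `M_g : h ↦ g h` on `L²(μ)`, for `g ∈ L^∞(μ)`. -/
def mulOp (μ : Measure X) (g : Lp ℂ ∞ μ) : Lp ℂ 2 μ →L[ℂ] Lp ℂ 2 μ :=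
  LinearMap.mkContinuous
    { toFun := fun h => (g • h : Lp ℂ 2 μ)
      map_add' := fun h₁ h₂ => Lp.add_smul g h₁ h₂
      map_smul' := fun c h => (Lp.smul_comm c g h).symm }
    ‖g‖ (fun h => Lp.norm_smul_le g h)

variable [TopologicalSpace X] [CompactSpace X] [BorelSpace X]

/-- The standard representation `π_μ : C(X) → B(L²(μ))`, `π_μ(f) = M_f`. -/
def stdRep (μ : Measure X) [IsFiniteMeasure μ] (f : C(X, ℂ)) : Lp ℂ 2 μ →L[ℂ] Lp ℂ 2 μ :=
  mulOp μ (ContinuousMap.toLp ∞ μ ℂ f)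

end Operators

/-- The strong dilation order `μ ≺_s ν`: there is a positive linear map `Φ : C(K) → L^∞(μ)`,
where `L^∞(μ)` acts on `L²(μ)` by multiplication, with `Φ(a) = π_μ(a)` for all `a ∈ A(K)` and
`ν(f) = ⟨Φ(f) 1, 1⟩` for all `f ∈ C(K)` (Mathlib's inner product is linear in the second
variable, so the arguments are interchanged). -/
def StrongDilationLE {E : Type*} [AddCommGroup E] [Module ℝ E] [TopologicalSpace E] {K : Set E}
    [CompactSpace K] [MeasurableSpace K] [BorelSpace K]
    (μ ν : Measure K) [IsFiniteMeasure μ] : Prop :=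
  ∃ Φ : C(K, ℂ) →ₚ[ℂ] Lp ℂ ∞ μ,
    (∀ a ∈ affineFunctions K, mulOp μ (Φ a) = stdRep μ a) ∧
    ∀ f : C(K, ℂ), ∫ x, f x ∂ν =
      inner ℂ (Lp.const 2 μ (1 : ℂ)) (mulOp μ (Φ f) (Lp.const 2 μ (1 : ℂ)))

end ChoquetDilation

end

/-! If `Φ` is positive and fixes the affine functions, then `Φ f ≥ f` almost everywhere for convex
`f`, because `f` is the supremum of its continuous affine minorants (`exists_affine_minorant`).
Integrating gives the Choquet order. Conversely, `exists_coupling` builds a positive functional `L`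
on `C(K × K)`, a dilation coupling. Its values are prescribed on `f(y) + G(x, y)` with `G` affine in
`y`, as `∫ f dν + ∫ G(x, x) dμ(x)`. Positivity there (`integral_add_integral_diag_nonneg`) is where
`μ ≺ ν` enters, and the M. Riesz extension theorem does the rest. The form `B f g = L(g(x) f(y))` is
then disintegrated over `μ`: `B f` is bounded in the `L²(μ)` norm, so it has a density `U f`.
Positivity and `U 1 = 1` put `U f` in `L^∞(μ)`, and its complexification is `Φ`. -/

namespace ChoquetDilation


section Complexification

variable {X : Type*} [TopologicalSpace X]

/-- A real continuous function, viewed as a complex-valued one. -/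
def complexify (f : C(X, ℝ)) : C(X, ℂ) := ⟨fun x => (f x : ℂ), by fun_prop⟩

@[simp]
theorem complexify_apply (f : C(X, ℝ)) (x : X) : complexify f x = (f x : ℂ) := rfl

theorem complexify_le {f g : C(X, ℝ)} (h : f ≤ g) : complexify f ≤ complexify g := fun x => by
  simpa using h x

end Complexification

theorem integrable_of_continuous {X : Type*} [TopologicalSpace X] [CompactSpace X]
    [MeasurableSpace X] [BorelSpace X] {F : Type*} [NormedAddCommGroup F]
    [SecondCountableTopologyEither X F] (μ : Measure X) [IsFiniteMeasure μ] (f : C(X, F)) :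
    Integrable f μ :=
  (map_continuous f).integrable_of_hasCompactSupport (HasCompactSupport.of_compactSpace _)

/-! ### Multiplication operators and their symbols -/

section Operators

variable {X : Type*} [MeasurableSpace X] (μ : Measure X) [IsFiniteMeasure μ]

/-- As `μ` is finite, `1` lies in `L²(μ)`, and evaluation there recovers the symbol. -/
theorem mulOp_const_one (g : Lp ℂ ∞ μ) :
    (mulOp μ g (Lp.const 2 μ (1 : ℂ)) : X → ℂ) =ᵐ[μ] g := by
  have h : (mulOp μ g (Lp.const 2 μ (1 : ℂ)) : X → ℂ) =ᵐ[μ]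
      (g : X → ℂ) • (Lp.const 2 μ (1 : ℂ) : X → ℂ) := Lp.coeFn_lpSMul g _
  filter_upwards [h, Lp.coeFn_const 2 μ (1 : ℂ)] with x hx h1
  rw [hx, Pi.smul_apply', h1, Function.const_apply, smul_eq_mul, mul_one]

theorem inner_one_mulOp (g : Lp ℂ ∞ μ) :
    inner ℂ (Lp.const 2 μ (1 : ℂ)) (mulOp μ g (Lp.const 2 μ (1 : ℂ))) = ∫ x, g x ∂μ := by
  rw [L2.inner_def]
  refine integral_congr_ae ?_
  filter_upwards [mulOp_const_one μ g, Lp.coeFn_const 2 μ (1 : ℂ)] with x hx h1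
  rw [hx, h1]
  simp

theorem mulOp_injective : Function.Injective (mulOp μ) := fun g h hgh => by
  refine Lp.ext ((mulOp_const_one μ g).symm.trans ?_)
  rw [hgh]
  exact mulOp_const_one μ h

end Operators

/-! ### From strong dilation to the Choquet order -/

section AffineMinorants

variable {E : Type*} [AddCommGroup E] [Module ℝ E] [TopologicalSpace E] {K : Set E}

/-- Hahn–Banach: a point strictly below the graph is separated from the closed convex epigraph. -/
theorem exists_affine_minorant [IsTopologicalAddGroup E] [ContinuousSMul ℝ E]
    [LocallyConvexSpace ℝ E] [T2Space E] [CompactSpace K] (hK : Convex ℝ K) {f : C(K, ℝ)}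
    (hf : f ∈ convexFunctions K) {x : K} {r : ℝ} (hr : r < f x) :
    ∃ a : C(K, ℝ), complexify a ∈ affineFunctions K ∧ a ≤ f ∧ a x = r := by
  classical
  set φ : E → ℝ := fun y => if h : y ∈ K then f ⟨y, h⟩ else 0 with hφ
  have hφK (y : K) : φ y = f y := by simp [hφ]
  have hcont : ContinuousOn φ K := by
    rw [continuousOn_iff_continuous_domRestrict]
    convert f.continuous using 1
    exact funext hφK
  have hconv : ConvexOn ℝ K φ := ⟨hK, fun y hy z hz a b ha hb hab => by
    have := hf ⟨y, hy⟩ ⟨z, hz⟩ ⟨a • y + b • z, hK hy hz ha hb hab⟩ a b ha hb hab rfl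
    rw [← hφK, ← hφK, ← hφK] at this
    simpa using this⟩
  obtain ⟨l, c, hle, heq⟩ := hconv.exists_affine_le_of_lt (𝕜 := ℝ) x.2 (by rwa [hφK])
    (isCompact_iff_compactSpace.2 ‹_›).isClosed hcont.lowerSemicontinuousOn
  refine ⟨⟨fun y => l y + c, by fun_prop⟩, ?_, fun y => ?_, by simpa using heq⟩
  · intro u v w a b _ _ hab hw
    simp only [complexify_apply, ContinuousMap.coe_mk, hw, map_add, map_smul, smul_eq_mul]
    have hab' : (a : ℂ) + b = 1 := by exact_mod_cast hab
    push_cast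
    linear_combination (-(c : ℂ)) * hab'
  · have := hle y
    simpa [hφK] using this

/-- A positive map fixing the affine functions increases the convex functions. -/
theorem le_re_of_fixes_affine [IsTopologicalAddGroup E] [ContinuousSMul ℝ E]
    [LocallyConvexSpace ℝ E] [T2Space E] [CompactSpace K] (hK : Convex ℝ K) [MeasurableSpace K]
    [BorelSpace K] (μ : Measure K) [IsFiniteMeasure μ] (Φ : C(K, ℂ) →ₚ[ℂ] Lp ℂ ∞ μ)
    (hΦ : ∀ a ∈ affineFunctions K, Φ a = ContinuousMap.toLp ∞ μ ℂ a) {f : C(K, ℝ)}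
    (hf : f ∈ convexFunctions K) : ∀ᵐ x ∂μ, f x ≤ (Φ (complexify f) x).re := by
  have key (n : ℕ) : ∀ᵐ x ∂μ, f x - 1 / ((n : ℝ) + 1) ≤ (Φ (complexify f) x).re := by
    have hn : (0 : ℝ) < 1 / ((n : ℝ) + 1) := by positivity
    choose a ha hle hax using fun x : K => exists_affine_minorant hK hf
      (x := x) (r := f x - 1 / ((n : ℝ) + 1) / 2) (by linarith)
    -- Compactness leaves finitely many minorants, so the exceptional null sets can be united.
    obtain ⟨t, ht⟩ := CompactSpace.elim_nhds_subcover
      (fun x => {y | f y - 1 / ((n : ℝ) + 1) < a x y}) fun x =>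
        (isOpen_lt (by fun_prop) (by fun_prop)).mem_nhds (by
          simp only [Set.mem_ofPred_eq, hax]; linarith)
    have hall : ∀ᵐ y ∂μ, ∀ x ∈ t, a x y ≤ (Φ (complexify f) y).re := by
      refine (Filter.eventually_all_finset t).2 fun x _ => ?_
      have h1 : Φ (complexify (a x)) ≤ Φ (complexify f) :=
        OrderHomClass.mono Φ (complexify_le (hle x))
      rw [hΦ _ (ha x), ← Lp.coeFn_le] at h1
      filter_upwards [h1, ContinuousMap.coeFn_toLp (p := ∞) (𝕜 := ℂ) μ (complexify (a x))]
        with y hy hy'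
      rw [hy'] at hy
      simpa using (Complex.le_def.1 hy).1
    filter_upwards [hall] with y hy
    have : y ∈ ⋃ x ∈ t, {y | f y - 1 / ((n : ℝ) + 1) < a x y} := by rw [ht]; trivial
    simp only [Set.mem_iUnion, Set.mem_ofPred_eq] at this
    obtain ⟨x, hx, hlt⟩ := this
    exact hlt.le.trans (hy x hx)
  filter_upwards [ae_all_iff.2 key] with x hx
  have ht := tendsto_one_div_add_atTop_nhds_zero_nat (𝕜 := ℝ) |>.const_add
    (Φ (complexify f) x).re
  rw [add_zero] at ht
  exact ge_of_tendsto' ht fun n => by linarith [hx n]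

theorem StrongDilationLE.choquetLE [IsTopologicalAddGroup E] [ContinuousSMul ℝ E]
    [LocallyConvexSpace ℝ E] [T2Space E] [CompactSpace K] (hK : Convex ℝ K) [MeasurableSpace K]
    [BorelSpace K] {μ ν : Measure K} [IsFiniteMeasure μ] (h : StrongDilationLE μ ν) :
    ChoquetLE μ ν := by
  obtain ⟨Φ, hΦ, hν⟩ := h
  intro f hf
  have hae := le_re_of_fixes_affine hK μ Φ (fun a ha => mulOp_injective μ (hΦ a ha)) hf
  have hint : Integrable (Φ (complexify f)) μ :=
    (Lp.memLp (Φ (complexify f))).integrable le_top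
  have h1 := hν (complexify f)
  rw [inner_one_mulOp] at h1
  simp only [complexify_apply, integral_complex_ofReal] at h1
  have h2 : ∫ x, (Φ (complexify f) x).re ∂μ = ∫ x, f x ∂ν := by
    have := integral_re hint
    simp only [RCLike.re_eq_complex_re] at this
    rw [this, ← h1, Complex.ofReal_re]
  rw [← h2]
  exact integral_mono_ae (integrable_of_continuous μ f) hint.re hae

end AffineMinorants


/-! ### The coupling functional on `K × K` -/

section Coupling

variable {E : Type*} [AddCommGroup E] [Module ℝ E] [TopologicalSpace E] {K : Set E}

/-- The continuous functions on `K × K` that are affine in the second variable. -/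
def affineInSnd (K : Set E) : Submodule ℝ C(K × K, ℝ) where
  carrier := {G | ∀ (u x y z : K) (a b : ℝ), 0 ≤ a → 0 ≤ b → a + b = 1 →
    (z : E) = a • (x : E) + b • (y : E) → G (u, z) = a * G (u, x) + b * G (u, y)}
  add_mem' {F G} hF hG u x y z a b ha hb hab hz := by
    simp only [ContinuousMap.add_apply, hF u x y z a b ha hb hab hz, hG u x y z a b ha hb hab hz]
    ring
  zero_mem' := by simp
  smul_mem' c F hF u x y z a b ha hb hab hz := by
    simp only [ContinuousMap.smul_apply, hF u x y z a b ha hb hab hz, smul_eq_mul]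
    ring

/-- The functional `f ↦ ∫ f dμ` on `C(X)`. -/
noncomputable def integralFunctional {X : Type*} [TopologicalSpace X] [CompactSpace X]
    [MeasurableSpace X] [BorelSpace X] (μ : Measure X) [IsFiniteMeasure μ] : C(X, ℝ) →ₗ[ℝ] ℝ where
  toFun f := ∫ x, f x ∂μ
  map_add' f g := integral_add (integrable_of_continuous μ f) (integrable_of_continuous μ g)
  map_smul' c f := integral_const_mul c f

/-- Put `m(y) = min_x G(x, y)`, a concave function. Then `-f ≤ m` and `m(x) ≤ G(x, x)`, so `-∫ f dν
≤ ∫ m dν ≤ ∫ m dμ ≤ ∫ G(x, x) dμ`. -/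
theorem integral_add_integral_diag_nonneg [CompactSpace K] [MeasurableSpace K] [BorelSpace K]
    {μ ν : Measure K} [IsFiniteMeasure μ] [IsFiniteMeasure ν] (h : ChoquetLE μ ν)
    {f : C(K, ℝ)} {G : C(K × K, ℝ)} (hG : G ∈ affineInSnd K)
    (hfG : ∀ x y, 0 ≤ f y + G (x, y)) : 0 ≤ ∫ y, f y ∂ν + ∫ x, G (x, x) ∂μ := by
  rcases isEmpty_or_nonempty K with hK | hK
  · simp [Measure.eq_zero_of_isEmpty]
  have hcont : Continuous fun y : K => sInf ((fun x : K => G (x, y)) '' Set.univ) :=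
    isCompact_univ.continuous_sInf (f := fun y x : K => G (x, y)) (by
      change Continuous fun p : K × K => G (p.2, p.1)
      fun_prop)
  set m : C(K, ℝ) := ⟨_, hcont⟩ with hm
  have hspec (y : K) : ∃ x, m y = G (x, y) ∧ ∀ x', m y ≤ G (x', y) := by
    obtain ⟨x, -, hx, hle⟩ := isCompact_univ.exists_sInf_image_eq_and_le Set.univ_nonempty
      (f := fun x : K => G (x, y)) (by fun_prop)
    exact ⟨x, hx, fun x' => hx.le.trans (hle x' trivial)⟩
  have hconv : -m ∈ convexFunctions K := by
    intro x y z a b ha hb hab hz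
    obtain ⟨u, hu, -⟩ := hspec z
    obtain ⟨-, -, hx⟩ := hspec x
    obtain ⟨-, -, hy⟩ := hspec y
    simp only [ContinuousMap.neg_apply, hu, hG u x y z a b ha hb hab hz]
    nlinarith [mul_le_mul_of_nonneg_left (hx u) ha, mul_le_mul_of_nonneg_left (hy u) hb]
  have h1 := h _ hconv
  simp only [ContinuousMap.neg_apply, integral_neg] at h1
  have h2 : ∫ y, -f y ∂ν ≤ ∫ y, m y ∂ν :=
    integral_mono (integrable_of_continuous ν f).neg (integrable_of_continuous ν m) fun y => by
      obtain ⟨x, hx, -⟩ := hspec y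
      have := hfG x y
      simp only [hx]
      linarith
  have h3 : ∫ x, m x ∂μ ≤ ∫ x, G (x, x) ∂μ :=
    integral_mono (integrable_of_continuous μ m)
      (integrable_of_continuous μ (G.comp ⟨fun x => (x, x), by fun_prop⟩)) fun x => by
        obtain ⟨-, -, hx⟩ := hspec x
        exact hx x
  rw [integral_neg] at h2
  linarith

/-- If `μ ≺ ν`, there is a positive functional on `C(K × K)` whose second marginal is `ν` and
which agrees with `G ↦ ∫ G(x, x) dμ(x)` on the functions that are affine in the second variable. -/
theorem ChoquetLE.exists_coupling [CompactSpace K] [MeasurableSpace K] [BorelSpace K]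
    {μ ν : Measure K} [IsFiniteMeasure μ] [IsFiniteMeasure ν] (h : ChoquetLE μ ν) :
    ∃ L : C(K × K, ℝ) →ₗ[ℝ] ℝ, (∀ F, 0 ≤ F → 0 ≤ L F) ∧
      (∀ f : C(K, ℝ), L (f.comp ⟨Prod.snd, continuous_snd⟩) = ∫ y, f y ∂ν) ∧
      ∀ G ∈ affineInSnd K, L G = ∫ x, G (x, x) ∂μ := by
  let W := C(K, ℝ) × affineInSnd K
  let snd : C(K, ℝ) →ₗ[ℝ] C(K × K, ℝ) :=
    { toFun := fun f => f.comp ⟨Prod.snd, continuous_snd⟩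
      map_add' := fun _ _ => rfl
      map_smul' := fun _ _ => rfl }
  let diag : C(K × K, ℝ) →ₗ[ℝ] C(K, ℝ) :=
    { toFun := fun f => f.comp ⟨fun x => (x, x), by fun_prop⟩
      map_add' := fun _ _ => rfl
      map_smul' := fun _ _ => rfl }
  let T : W →ₗ[ℝ] C(K × K, ℝ) := snd.coprod (affineInSnd K).subtype
  let ℓ : W →ₗ[ℝ] ℝ :=
    (integralFunctional ν).coprod (integralFunctional μ ∘ₗ diag ∘ₗ (affineInSnd K).subtype)
  have hTapp (f : C(K, ℝ)) (G : affineInSnd K) (p : K × K) : T (f, G) p = f p.2 + G.1 p := rfl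
  have hℓ (f : C(K, ℝ)) (G : affineInSnd K) :
      ℓ (f, G) = ∫ y, f y ∂ν + ∫ x, G.1 (x, x) ∂μ := rfl
  -- `T` need not be injective, so `ℓ` is not yet a functional on its range. Extending from `0 × W`
  -- inside the product avoids this.
  let s : PointedCone ℝ (C(K × K, ℝ) × W) :=
    { carrier := {p | 0 ≤ p.1 + T p.2}
      add_mem' := fun {p q} hp hq => by
        have : (p + q).1 + T (p + q).2 = (p.1 + T p.2) + (q.1 + T q.2) := by
          simp only [Prod.fst_add, Prod.snd_add, map_add]; abel
        simpa only [Set.mem_ofPred_eq, this] using add_nonneg hp hq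
      zero_mem' := by simp
      smul_mem' := fun c p hp => by
        have : (c • p).1 + T (c • p).2 = (c : ℝ) • (p.1 + T p.2) := by
          rw [smul_add, ← map_smul]; rfl
        simpa only [Set.mem_ofPred_eq, this] using smul_nonneg c.2 hp }
  let P : (C(K × K, ℝ) × W) →ₗ.[ℝ] ℝ :=
    { domain := Submodule.prod ⊥ ⊤
      toFun := ℓ ∘ₗ LinearMap.snd ℝ _ _ ∘ₗ (Submodule.prod ⊥ ⊤).subtype }
  obtain ⟨g, hgP, hgs⟩ := riesz_extension s P (by
    rintro ⟨⟨F, f, G⟩, hF⟩ hp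
    obtain rfl : F = 0 := by simpa [P] using hF
    refine integral_add_integral_diag_nonneg h G.2 fun x y => ?_
    have : 0 ≤ (0 : C(K × K, ℝ)) + T (f, G) := hp
    rw [zero_add] at this
    exact this (x, y)) (by
    rintro ⟨F, w⟩
    refine ⟨⟨(0, (ContinuousMap.const K ‖F‖, 0) - w), by simp [P]⟩, ?_⟩
    change 0 ≤ (0 + F) + T ((ContinuousMap.const K ‖F‖, 0) - w + w)
    rw [sub_add_cancel, zero_add]
    intro x
    have := neg_le_of_abs_le (F.norm_coe_le_norm x)
    change 0 ≤ F x + T (ContinuousMap.const K ‖F‖, 0) x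
    rw [hTapp]
    simp
    linarith)
  -- Both `(T w, -w)` and its negative lie in the cone, so `g` vanishes there.
  have hT (w : W) : g (T w, 0) = ℓ w := by
    have h1 : g (0, w) = ℓ w := hgP ⟨(0, w), by simp [P]⟩
    have h2 := hgs (T w, -w) (by change 0 ≤ T w + T (-w); simp)
    have h3 := hgs (-(T w), w) (by change 0 ≤ -T w + T w; simp)
    have h4 : g (T w, -w) = g (T w, 0) - g (0, w) := by rw [← map_sub]; simp
    have h5 : g (-(T w), w) = g (0, w) - g (T w, 0) := by rw [← map_sub]; simp
    linarith
  refine ⟨g ∘ₗ LinearMap.inl ℝ _ _, fun F hF => hgs _ (by change 0 ≤ F + T 0; simpa using hF),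
    fun f => ?_, fun G hG => ?_⟩
  · have hTf : T (f, 0) = f.comp ⟨Prod.snd, continuous_snd⟩ := by
      ext p
      simp [hTapp]
    have := hT (f, 0)
    rw [hTf, hℓ] at this
    simpa using this
  · have hTG : T (0, ⟨G, hG⟩) = G := by
      ext p
      simp [hTapp]
    have := hT (0, ⟨G, hG⟩)
    rw [hTG, hℓ] at this
    simpa using this

end Coupling


/-! ### Real densities of positive bilinear forms -/

section Density

/-- Expand the positivity of `B` on the four pairs `(‖f‖ ± f, |g| ± g)` and add suitable pairs of
inequalities. -/
theorem abs_bilin_le {X : Type*} [TopologicalSpace X] [CompactSpace X] [MeasurableSpace X]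
    {μ : Measure X} {B : C(X, ℝ) →ₗ[ℝ] C(X, ℝ) →ₗ[ℝ] ℝ} (hB : ∀ f g, 0 ≤ f → 0 ≤ g → 0 ≤ B f g)
    (hB1 : ∀ g, B 1 g = ∫ x, g x ∂μ) (f g : C(X, ℝ)) :
    |B f g| ≤ ‖f‖ * ∫ x, |g x| ∂μ := by
  have hf (x : X) := abs_le.1 (f.norm_coe_le_norm x)
  have h1 : 0 ≤ ‖f‖ • (1 : C(X, ℝ)) - f := fun x => by
    have := (hf x).2
    simp
    linarith
  have h2 : 0 ≤ ‖f‖ • (1 : C(X, ℝ)) + f := fun x => by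
    have := (hf x).1
    simp
    linarith
  have h3 : 0 ≤ |g| - g := fun x => by
    have := le_abs_self (g x)
    simp
    linarith
  have h4 : 0 ≤ |g| + g := fun x => by
    have := neg_abs_le (g x)
    simp
    linarith
  have e1 := hB _ _ h1 h3
  have e2 := hB _ _ h1 h4
  have e3 := hB _ _ h2 h3
  have e4 := hB _ _ h2 h4
  have habs : B 1 |g| = ∫ x, |g x| ∂μ := by rw [hB1]; rfl
  simp only [map_sub, map_add, map_smul, LinearMap.sub_apply, LinearMap.add_apply,
    LinearMap.smul_apply, smul_eq_mul, habs] at e1 e2 e3 e4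
  rw [abs_le]
  constructor <;> linarith

variable {X : Type*} [TopologicalSpace X] [CompactSpace X] [MeasurableSpace X] [BorelSpace X]
  {μ : Measure X} [IsFiniteMeasure μ]

/-- By density the hypothesis extends to positive parts of all `v` in `L²`. Taking `v = -u` forces
the negative part of `u` to vanish. -/
theorem nonneg_of_inner_toLp_nonneg [T2Space X] [μ.WeaklyRegular] {u : Lp ℝ 2 μ}
    (hu : ∀ g : C(X, ℝ), 0 ≤ g → 0 ≤ inner ℝ u (ContinuousMap.toLp 2 μ ℝ g)) :
    ∀ᵐ x ∂μ, 0 ≤ u x := by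
  have hpos (v : Lp ℝ 2 μ) : 0 ≤ inner ℝ u (Lp.posPart v) := by
    refine (ContinuousMap.toLp_denseRange ℝ μ ℝ (p := 2) (by simp)).induction_on
      (p := fun v => 0 ≤ inner ℝ u (Lp.posPart v)) v
      (isClosed_le continuous_const (continuous_const.inner Lp.continuous_posPart)) fun g => ?_
    have : Lp.posPart (ContinuousMap.toLp 2 μ ℝ g) = ContinuousMap.toLp 2 μ ℝ (g ⊔ 0) := by
      refine Lp.ext ?_
      filter_upwards [Lp.coeFn_posPart (ContinuousMap.toLp 2 μ ℝ g),
        ContinuousMap.coeFn_toLp (p := 2) (𝕜 := ℝ) μ g,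
        ContinuousMap.coeFn_toLp (p := 2) (𝕜 := ℝ) μ (g ⊔ 0)] with x h1 h2 h3
      rw [h1, h2, h3]
      rfl
    rw [this]
    exact hu _ le_sup_right
  have h1 : inner ℝ u (Lp.posPart (-u)) = -inner ℝ (Lp.posPart (-u)) (Lp.posPart (-u)) := by
    rw [L2.inner_def, L2.inner_def, ← integral_neg]
    refine integral_congr_ae ?_
    filter_upwards [Lp.coeFn_posPart (-u), Lp.coeFn_neg u] with x hx hx'
    simp only [hx, hx', Pi.neg_apply]
    rcases le_total (u x) 0 with h | h
    · rw [max_eq_left (by linarith)]; simp [sq]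
    · rw [max_eq_right (by linarith)]; simp
  have h2 : Lp.posPart (-u) = 0 := by
    rw [← inner_self_eq_zero (𝕜 := ℝ)]
    have := hpos (-u)
    rw [h1] at this
    exact le_antisymm (by linarith) real_inner_self_nonneg
  filter_upwards [Lp.coeFn_posPart (-u), Lp.coeFn_neg u, Lp.coeFn_zero ℝ 2 μ] with x hx hx' h0
  rw [h2, h0, hx'] at hx
  have := le_max_left ((-(u : X → ℝ)) x) 0
  rw [← hx] at this
  simpa using this

variable {B : C(X, ℝ) →ₗ[ℝ] C(X, ℝ) →ₗ[ℝ] ℝ}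

theorem integral_abs_le_norm_toLp (g : C(X, ℝ)) :
    ∫ x, |g x| ∂μ ≤ ‖ContinuousMap.toLp 2 μ ℝ (1 : C(X, ℝ))‖ * ‖ContinuousMap.toLp 2 μ ℝ g‖ := by
  have h1 : ∫ x, |g x| ∂μ =
      inner ℝ (ContinuousMap.toLp 2 μ ℝ (1 : C(X, ℝ))) (ContinuousMap.toLp 2 μ ℝ |g|) := by
    rw [ContinuousMap.inner_toLp]
    simp
  have h2 : ‖ContinuousMap.toLp 2 μ ℝ |g|‖ ≤ ‖ContinuousMap.toLp 2 μ ℝ g‖ := by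
    refine Lp.norm_le_norm_of_ae_le ?_
    filter_upwards [ContinuousMap.coeFn_toLp (p := 2) (𝕜 := ℝ) μ g,
      ContinuousMap.coeFn_toLp (p := 2) (𝕜 := ℝ) μ |g|] with x h1 h2
    rw [h1, h2]
    simp
  rw [h1]
  exact (real_inner_le_norm _ _).trans (by gcongr)

/-- A positive bilinear form on `C(X)` with marginal `μ` is represented by an `L²(μ)`-valued map. -/
theorem exists_density_map [T2Space X] [μ.WeaklyRegular]
    (hB : ∀ f g, 0 ≤ f → 0 ≤ g → 0 ≤ B f g) (hB1 : ∀ g, B 1 g = ∫ x, g x ∂μ) :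
    ∃ U : C(X, ℝ) →ₗ[ℝ] Lp ℝ 2 μ, ∀ f g, inner ℝ (U f) (ContinuousMap.toLp 2 μ ℝ g) = B f g := by
  have hd : DenseRange (ContinuousMap.toLp 2 μ ℝ : C(X, ℝ) →L[ℝ] Lp ℝ 2 μ) :=
    ContinuousMap.toLp_denseRange ℝ μ ℝ (by simp)
  have hex (f : C(X, ℝ)) : ∃ u : Lp ℝ 2 μ, ∀ g, inner ℝ u (ContinuousMap.toLp 2 μ ℝ g) = B f g := by
    let e : C(X, ℝ) →ₗ[ℝ] Lp ℝ 2 μ := (ContinuousMap.toLp 2 μ ℝ : C(X, ℝ) →L[ℝ] Lp ℝ 2 μ)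
    -- Riesz representation of the `L²`-continuous extension of `B f`.
    refine ⟨(InnerProductSpace.toDual ℝ (Lp ℝ 2 μ)).symm ((B f).extendOfNorm e), fun g => ?_⟩
    rw [InnerProductSpace.toDual_symm_apply]
    refine LinearMap.extendOfNorm_eq (e := e) hd
      ⟨‖f‖ * ‖ContinuousMap.toLp 2 μ ℝ (1 : C(X, ℝ))‖, fun g => ?_⟩ g
    rw [mul_assoc]
    exact (abs_bilin_le hB hB1 f g).trans (by gcongr; exact integral_abs_le_norm_toLp g)
  choose u hu using hex
  refine ⟨{ toFun := u, map_add' := fun f f' => ?_, map_smul' := fun c f => ?_ }, hu⟩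
  · exact hd.eq_of_inner_left ℝ fun g => by simp [inner_add_left, hu]
  · exact hd.eq_of_inner_left ℝ fun g => by simp [real_inner_smul_left, hu]

end Density


/-! ### Complexification and the `L^∞` bound -/

section ComplexDensity

variable {X : Type*} [TopologicalSpace X]

/-- The real part of a complex-valued continuous function. -/
noncomputable def rePart (f : C(X, ℂ)) : C(X, ℝ) := ⟨fun x => (f x).re, by fun_prop⟩

/-- The imaginary part of a complex-valued continuous function. -/
noncomputable def imPart (f : C(X, ℂ)) : C(X, ℝ) := ⟨fun x => (f x).im, by fun_prop⟩

theorem rePart_add (f g : C(X, ℂ)) : rePart (f + g) = rePart f + rePart g := rfl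

theorem imPart_add (f g : C(X, ℂ)) : imPart (f + g) = imPart f + imPart g := rfl

theorem rePart_smul (c : ℂ) (f : C(X, ℂ)) :
    rePart (c • f) = c.re • rePart f + (-c.im) • imPart f := by
  ext x
  simp [rePart, imPart, sub_eq_add_neg]

theorem imPart_smul (c : ℂ) (f : C(X, ℂ)) :
    imPart (c • f) = c.re • imPart f + c.im • rePart f := by
  ext x
  simp [rePart, imPart]

/-- An essentially bounded real `L²`-valued map on `C(X, ℝ)` extends to a complex linear
`L^∞`-valued map on `C(X, ℂ)`. -/
theorem exists_complexification [CompactSpace X] [MeasurableSpace X] {μ : Measure X}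
    (U : C(X, ℝ) →ₗ[ℝ] Lp ℝ 2 μ)
    (hU : ∀ f, ∀ᵐ x ∂μ, |U f x| ≤ ‖f‖) :
    ∃ Φ : C(X, ℂ) →ₗ[ℂ] Lp ℂ ∞ μ, ∀ f,
      (Φ f : X → ℂ) =ᵐ[μ] fun x => (U (rePart f) x : ℂ) + U (imPart f) x * Complex.I := by
  have hmeas (f : C(X, ℝ)) : AEStronglyMeasurable (fun x => (U f x : ℂ)) μ :=
    Complex.continuous_ofReal.comp_aestronglyMeasurable (Lp.aestronglyMeasurable (U f))
  have hmem (f : C(X, ℂ)) :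
      MemLp (fun x => (U (rePart f) x : ℂ) + U (imPart f) x * Complex.I) ∞ μ := by
    refine memLp_top_of_bound ((hmeas _).add ((hmeas _).mul_const _))
      (‖rePart f‖ + ‖imPart f‖) ?_
    filter_upwards [hU (rePart f), hU (imPart f)] with x h1 h2
    refine (norm_add_le _ _).trans (add_le_add ?_ ?_)
    · simpa using h1
    · simpa using h2
  refine ⟨{ toFun := fun f => (hmem f).toLp, map_add' := fun f g => ?_,
            map_smul' := fun c f => ?_ }, fun f => (hmem f).coeFn_toLp⟩
  · rw [← MemLp.toLp_add]
    refine MemLp.toLp_congr _ _ ?_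
    rw [rePart_add, imPart_add, map_add, map_add]
    filter_upwards [Lp.coeFn_add (U (rePart f)) (U (rePart g)),
      Lp.coeFn_add (U (imPart f)) (U (imPart g))] with x h1 h2
    simp only [h1, h2, Pi.add_apply]
    push_cast
    ring
  · simp only [RingHom.id_apply]
    rw [← MemLp.toLp_const_smul]
    refine MemLp.toLp_congr _ _ ?_
    rw [rePart_smul, imPart_smul]
    simp only [map_add, map_smul]
    filter_upwards [Lp.coeFn_add (c.re • U (rePart f)) ((-c.im) • U (imPart f)),
      Lp.coeFn_add (c.re • U (imPart f)) (c.im • U (rePart f)),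
      Lp.coeFn_smul c.re (U (rePart f)), Lp.coeFn_smul (-c.im) (U (imPart f)),
      Lp.coeFn_smul c.re (U (imPart f)), Lp.coeFn_smul c.im (U (rePart f))]
      with x h1 h2 h3 h4 h5 h6
    simp only [h1, h2, h3, h4, h5, h6, Pi.add_apply, Pi.smul_apply, smul_eq_mul]
    apply Complex.ext
    · simp
      ring
    · simp

variable [CompactSpace X] [MeasurableSpace X] [BorelSpace X] {μ : Measure X} [IsFiniteMeasure μ]
  {B : C(X, ℝ) →ₗ[ℝ] C(X, ℝ) →ₗ[ℝ] ℝ}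

/-- A positive bilinear form on `C(X)` with marginal `μ` is represented by a positive map from
`C(X)` to `L^∞(μ)`. -/
theorem exists_positive_density_map [T2Space X] [μ.WeaklyRegular]
    (hB : ∀ f g, 0 ≤ f → 0 ≤ g → 0 ≤ B f g) (hB1 : ∀ g, B 1 g = ∫ x, g x ∂μ) :
    ∃ Φ : C(X, ℂ) →ₚ[ℂ] Lp ℂ ∞ μ,
      (∀ f, ∫ x, Φ f x ∂μ = B (rePart f) 1 + B (imPart f) 1 * Complex.I) ∧
      ∀ f, (∀ g, B (rePart f) g = ∫ x, g x * rePart f x ∂μ) →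
        (∀ g, B (imPart f) g = ∫ x, g x * imPart f x ∂μ) → Φ f = ContinuousMap.toLp ∞ μ ℂ f := by
  obtain ⟨U, hU⟩ := exists_density_map hB hB1
  have hd : DenseRange (ContinuousMap.toLp 2 μ ℝ : C(X, ℝ) →L[ℝ] Lp ℝ 2 μ) :=
    ContinuousMap.toLp_denseRange ℝ μ ℝ (by simp)
  have hfix (f : C(X, ℝ)) (hf : ∀ g, B f g = ∫ x, g x * f x ∂μ) :
      U f = ContinuousMap.toLp 2 μ ℝ f :=
    hd.eq_of_inner_left ℝ fun g => by
      rw [hU, hf, ContinuousMap.inner_toLp]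
      simp
  have hnonneg (f : C(X, ℝ)) (hf : 0 ≤ f) : ∀ᵐ x ∂μ, 0 ≤ U f x :=
    nonneg_of_inner_toLp_nonneg fun g hg => by rw [hU]; exact hB f g hf hg
  have hmono (f g : C(X, ℝ)) (hfg : f ≤ g) : ∀ᵐ x ∂μ, U f x ≤ U g x := by
    filter_upwards [hnonneg (g - f) (sub_nonneg.2 hfg), Lp.coeFn_sub (U g) (U f)] with x h1 h2
    rw [map_sub, h2, Pi.sub_apply] at h1
    linarith
  have hone (c : ℝ) : ∀ᵐ x ∂μ, U (c • 1) x = c := by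
    have h1 : U 1 = ContinuousMap.toLp 2 μ ℝ (1 : C(X, ℝ)) := hfix 1 fun g => by simp [hB1]
    rw [map_smul, h1]
    filter_upwards [Lp.coeFn_smul c (ContinuousMap.toLp 2 μ ℝ (1 : C(X, ℝ))),
      ContinuousMap.coeFn_toLp (p := 2) (𝕜 := ℝ) μ (1 : C(X, ℝ))] with x h1 h2
    rw [h1, Pi.smul_apply, h2]
    simp
  -- Apply the monotone map `U` to `-‖f‖ ≤ f ≤ ‖f‖`; it fixes constants.
  have hbdd (f : C(X, ℝ)) : ∀ᵐ x ∂μ, |U f x| ≤ ‖f‖ := by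
    have hf (x : X) := abs_le.1 (f.norm_coe_le_norm x)
    filter_upwards [hmono f (‖f‖ • 1) fun x => by simpa using (hf x).2,
      hmono ((-‖f‖) • 1) f fun x => by simpa using (hf x).1, hone ‖f‖, hone (-‖f‖)]
      with x h1 h2 h3 h4
    exact abs_le.2 ⟨h4 ▸ h2, h3 ▸ h1⟩
  obtain ⟨Φ, hΦ⟩ := exists_complexification U hbdd
  refine ⟨PositiveLinearMap.mk₀ Φ fun f hf => ?_, fun f => ?_, fun f hre him => ?_⟩
  · rw [← Lp.coeFn_nonneg]
    have him : imPart f = 0 := by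
      ext x
      exact (Complex.le_def.1 (hf x)).2.symm
    filter_upwards [hΦ f, hnonneg (rePart f) fun x => (Complex.le_def.1 (hf x)).1,
      Lp.coeFn_zero ℝ 2 μ] with x h1 h2 h3
    rw [h1, him, map_zero, h3]
    simpa using h2
  · have hint (f : C(X, ℝ)) : Integrable (U f) μ := (Lp.memLp (U f)).integrable (by norm_num)
    have hI (f : C(X, ℝ)) : ∫ x, U f x ∂μ = B f 1 := by
      rw [← hU, L2.inner_def]
      refine integral_congr_ae ?_
      filter_upwards [ContinuousMap.coeFn_toLp (p := 2) (𝕜 := ℝ) μ (1 : C(X, ℝ))] with x hx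
      rw [hx]
      simp
    change ∫ x, Φ f x ∂μ = _
    rw [integral_congr_ae (hΦ f), integral_add (hint _).ofReal ((hint _).ofReal.mul_const _),
      integral_mul_const, integral_complex_ofReal,
      integral_complex_ofReal, hI, hI]
  · refine Lp.ext ((hΦ f).trans ?_)
    rw [hfix _ hre, hfix _ him]
    filter_upwards [ContinuousMap.coeFn_toLp (p := 2) (𝕜 := ℝ) μ (rePart f),
      ContinuousMap.coeFn_toLp (p := 2) (𝕜 := ℝ) μ (imPart f),
      ContinuousMap.coeFn_toLp (p := ∞) (𝕜 := ℂ) μ f] with x h1 h2 h3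
    rw [h1, h2, h3]
    exact Complex.re_add_im (f x)

end ComplexDensity

/-! ### From the Choquet order to strong dilation -/

section Main

variable {E : Type*} [AddCommGroup E] [Module ℝ E] [TopologicalSpace E] {K : Set E}

theorem ChoquetLE.strongDilationLE [T2Space E] [CompactSpace K] [MeasurableSpace K] [BorelSpace K]
    {μ ν : Measure K} [IsFiniteMeasure μ] [μ.WeaklyRegular] [IsFiniteMeasure ν]
    (h : ChoquetLE μ ν) : StrongDilationLE μ ν := by
  obtain ⟨L, hL, hLν, hLμ⟩ := h.exists_coupling
  -- `f` sits in the second variable, so affine `f` makes `T f g` affine there for every `g`.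
  let T (f g : C(K, ℝ)) : C(K × K, ℝ) := ⟨fun p => g p.1 * f p.2, by fun_prop⟩
  let B : C(K, ℝ) →ₗ[ℝ] C(K, ℝ) →ₗ[ℝ] ℝ := LinearMap.mk₂ ℝ (fun f g => L (T f g))
    (fun f f' g => by rw [← map_add]; congr 1; ext p; exact mul_add _ _ _)
    (fun c f g => by rw [← map_smul]; congr 1; ext p; exact mul_left_comm _ _ _)
    (fun f g g' => by rw [← map_add]; congr 1; ext p; exact add_mul _ _ _)
    (fun c f g => by rw [← map_smul]; congr 1; ext p; exact mul_assoc _ _ _)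
  have hBaff (f g : C(K, ℝ)) (hf : ∀ (x y z : K) (a b : ℝ), 0 ≤ a → 0 ≤ b → a + b = 1 →
      (z : E) = a • (x : E) + b • (y : E) → f z = a * f x + b * f y) :
      B f g = ∫ x, g x * f x ∂μ :=
    hLμ (T f g) fun u x y z a b ha hb hab hz => by
      simp only [T, ContinuousMap.coe_mk, hf x y z a b ha hb hab hz]
      ring
  have hB1 (f : C(K, ℝ)) : B f 1 = ∫ x, f x ∂ν := by
    rw [← hLν]
    change L (T f 1) = _
    congr 1
    ext p
    exact one_mul _
  obtain ⟨Φ, hΦν, hΦ⟩ := exists_positive_density_map (μ := μ) (B := B)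
    (fun f g hf hg => hL _ fun p => mul_nonneg (hg p.1) (hf p.2))
    (fun g => by
      rw [hBaff]
      · simp
      · intro x y z a b _ _ hab _
        simpa using hab.symm)
  refine ⟨Φ, fun a ha => ?_, fun f => ?_⟩
  · rw [stdRep, hΦ a]
    · refine fun g => hBaff _ _ fun x y z s t hs ht hst hz => ?_
      have := congrArg Complex.re (ha x y z s t hs ht hst hz)
      simpa [rePart] using this
    · refine fun g => hBaff _ _ fun x y z s t hs ht hst hz => ?_
      have := congrArg Complex.im (ha x y z s t hs ht hst hz)
      simpa [imPart] using this
  · rw [inner_one_mulOp, hΦν, hB1, hB1]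
    exact (integral_re_add_im (integrable_of_continuous ν f)).symm

end Main

end ChoquetDilation

theorem theoremT {E : Type*} [AddCommGroup E] [Module ℝ E] [TopologicalSpace E]
    [IsTopologicalAddGroup E] [ContinuousSMul ℝ E] [LocallyConvexSpace ℝ E] [T2Space E]
    {K : Set E} [CompactSpace K] (hK : Convex ℝ K) [MeasurableSpace K] [BorelSpace K]
    (μ ν : Measure K) [IsFiniteMeasure μ] [μ.Regular] [IsFiniteMeasure ν] [ν.Regular] :
    ChoquetDilation.ChoquetLE μ ν ↔ ChoquetDilation.StrongDilationLE μ ν :=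
  ⟨ChoquetDilation.ChoquetLE.strongDilationLE, ChoquetDilation.StrongDilationLE.choquetLE hK⟩
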